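/- **Theorem 5 (Wasserstein uncertainty set).** Let $\mathcal S$ (a finite metric space with metric $d$) and $\mathcal A$ be finite non-empty state and action sets, $H$ a horizon, $r_h:\mathcal S\times\mathcal A\to[0,1]$ $(1\le h\le H)$ known rewards, and $P^o_{h,s,a}$ unknown nominal next-state distributions on $\mathcal S$. Let $p\in[1,\infty)$, $\rho>0$, $B_p=\max_{s,s'}d(s,s')^p$, and $$W_p(P,Q)=\Big(\inf_{\nu}\int d^p(x,y)\,d\nu(x,y)\Big)^{1/p},$$ the infimum being over all probability measures $\nu$ on $\mathcal S\times\mathcal S$ with marginals $P$ and $Q$. Let $\mathcal P=\bigotimes_{h,s,a}\mathcal P_{h,s,a}$ with $\mathcal P_{h,s,a}=\{P\in\Delta(\mathcal S):W_p(P,P^o_{h,s,a})\le\rho\}$. For a deterministic non-stationary Markov policy $\pi=(\pi_h)_{h=1}^H$ let $$V^\pi(s)=\inf_{P\in\mathcal P}\mathbb E_{\pi,P}\Big[\sum_{h=1}^H r_h(s_h,a_h)\,\Big|\,s_1=s\Big],\qquad V^*(s)=\sup_\pi V^\pi(s).$$ The algorithm RPVL (Robust Phased Value Learning) draws, for each $(h,s,a)$,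 $N$ samples from $P^o_{h,s,a}$, all samples being independent, so that the total number of samples is $N_{\mathrm{total}}=N|\mathcal S||\mathcal A|H$. It forms the empirical frequencies $\widehat P^o_{h,s,a}$ and $\widehat{\mathcal P}_{h,s,a}=\{P\in\Delta(\mathcal S):W_p(P,\widehat P^o_{h,s,a})\le\rho\}$, sets $\widehat V_{H+1}=0$ and, for $h=H,\dots,1$, $$\widehat V_h(s)=\max_a\Big\{r_h(s,a)+\inf_{P\in\widehat{\mathcal P}_{h,s,a}}\sum_{s'}P(s')\widehat V_{h+1}(s')\Big\},$$ and outputs a policy $\widehat\pi=(\widehat\pi_h)_{h=1}^H$ in which $\widehat\pi_h(s)$ is a maximizing action (with any tie-breaking). Fix $\delta\in(0,1)$ and $\epsilon\in(0,H)$. If $N_{\mathrm{total}}\ge N_{\mathrm W}$, where $$N_{\mathrm W}=\frac{8H^5|\mathcal S||\mathcal A|(B_p+\rho^p)^2}{\rho^{2p}\epsilon^2}\cdot\log\frac{16H^2|\mathcal S||\mathcal A|\big(HB_p+\max(H,\rho^p)\big)}{\rho^p\,\delta\,\epsilon},$$ then, with probability at least $1-\delta$, $\ \|V^*-V^{\widehat\pi}\|_\infty\le\epsilon$.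 -/

import Mathlib

open scoped BigOperators

noncomputable section

namespace RPVL

variable {S A : Type*} {H N : ℕ}

/-- `ν` is a probability vector on `S × S` with first marginal `P` and second marginal `Q`. -/
def IsCoupling [Fintype S] (ν : S × S → ℝ) (P Q : S → ℝ) : Prop :=
  ν ∈ stdSimplex ℝ (S × S) ∧ (∀ x, ∑ y, ν (x, y) = P x) ∧ (∀ y, ∑ x, ν (x, y) = Q y)

/-- The optimal transport cost `inf_ν ∫ d(x,y)^p dν(x,y)` over the couplings of `P` and `Q`. -/
def transportCost [Fintype S] [MetricSpace S] (p : ℝ) (P Q : S → ℝ) : ℝ :=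
  sInf {c : ℝ | ∃ ν : S × S → ℝ, IsCoupling ν P Q ∧ c = ∑ z, dist z.1 z.2 ^ p * ν z}

/-- The `p`-Wasserstein distance between two probability vectors. -/
def wasserstein [Fintype S] [MetricSpace S] (p : ℝ) (P Q : S → ℝ) : ℝ :=
  transportCost p P Q ^ (1 / p)

/-- The `p`-Wasserstein ball of radius `ρ` around `Q` in the probability simplex. -/
def wassersteinBall [Fintype S] [MetricSpace S] (p ρ : ℝ) (Q : S → ℝ) : Set (S → ℝ) :=
  {P | P ∈ stdSimplex ℝ S ∧ wasserstein p P Q ≤ ρ}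

/-- `B_p = max_{s,s'} d(s,s')^p`. -/
def maxDistPow (S : Type*) [MetricSpace S] (p : ℝ) : ℝ :=
  ⨆ z : S × S, dist z.1 z.2 ^ p

/-- A (time-dependent) transition model: `P h s a s'` is the probability of moving to `s'` when
action `a` is taken in state `s` at step `h`. The `H` steps are indexed by `Fin H`. -/
abbrev Model (S A : Type*) (H : ℕ) : Type _ := Fin H → S → A → S → ℝ

/-- Deterministic non-stationary Markov policies. -/
abbrev Policy (S A : Type*) (H : ℕ) : Type _ := Fin H → S → A

/-- The `(s,a)`-rectangular uncertainty set: the product over all `(h,s,a)` of the Wasserstein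
balls around the given model. -/
def uncertaintySet [Fintype S] [MetricSpace S] (p ρ : ℝ) (P₀ : Model S A H) :
    Set (Model S A H) :=
  {P | ∀ h s a, P h s a ∈ wassersteinBall p ρ (P₀ h s a)}

/-- The probability of the trajectory `x 0, x 1, …, x H` of states, given its initial state, when
policy `π` is used in model `P`. -/
def trajProb (P : Model S A H) (π : Policy S A H) (x : Fin (H + 1) → S) : ℝ :=
  ∏ h : Fin H, P h (x h.castSucc) (π h (x h.castSucc)) (x h.succ)

/-- The total reward collected along a trajectory. -/
def totalReward (r : Fin H → S → A → ℝ) (π : Policy S A H) (x : Fin (H + 1) → S) : ℝ :=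
  ∑ h : Fin H, r h (x h.castSucc) (π h (x h.castSucc))

/-- The value (from the first step on) of `π` in model `P`: the expected total reward over the
trajectories that start in `s`. -/
def value [Fintype S] (r : Fin H → S → A → ℝ) (P : Model S A H) (π : Policy S A H) (s : S) : ℝ :=
  ∑ y : Fin H → S,
    trajProb P π (Fin.cons s y : Fin (H + 1) → S) *
      totalReward r π (Fin.cons s y : Fin (H + 1) → S)

/-- The robust value of `π`: the worst case over the uncertainty set around `P₀`. -/
def robustValue [Fintype S] [MetricSpace S] (p ρ : ℝ) (r : Fin H → S → A → ℝ)
    (P₀ : Model S A H) (π : Policy S A H) (s : S) : ℝ :=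
  sInf ((fun P => value r P π s) '' uncertaintySet p ρ P₀)

/-- The optimal robust value. -/
def optRobustValue [Fintype S] [MetricSpace S] (p ρ : ℝ) (r : Fin H → S → A → ℝ)
    (P₀ : Model S A H) (s : S) : ℝ :=
  ⨆ π : Policy S A H, robustValue p ρ r P₀ π s

/-- `L_K V = inf {P V : P ∈ K}`. -/
def worstCase [Fintype S] (K : Set (S → ℝ)) (V : S → ℝ) : ℝ :=
  sInf ((fun P : S → ℝ => ∑ s, P s * V s) '' K)

open Classical in
/-- The maximum likelihood estimate of the model: `D h s a i` is the `i`-th sampled next state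
for `(h,s,a)`, and the estimate is the frequency of `s'` among the `N` samples. -/
def empiricalModel (D : Fin H → S → A → Fin N → S) : Model S A H :=
  fun h s a s' => ((Finset.univ.filter fun i => D h s a i = s').card : ℝ) / N

/-- One-step robust look-ahead `r_h(s,a) + L_{𝒫_{h,s,a}} V`, with `𝒫_{h,s,a}` the ball around
`P₀ h s a`. -/
def robustQ [Fintype S] [MetricSpace S] (p ρ : ℝ) (r : Fin H → S → A → ℝ)
    (P₀ : Model S A H) (h : Fin H) (V : S → ℝ) (s : S) (a : A) : ℝ :=
  r h s a + worstCase (wassersteinBall p ρ (P₀ h s a)) V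

/-- Robust backward induction: the value after the last step is `0`, and
`V_h(s) = max_a (r_h(s,a) + L_{𝒫_{h,s,a}} V_{h+1})`. -/
def robustDP [Fintype S] [MetricSpace S] (p ρ : ℝ) (r : Fin H → S → A → ℝ)
    (P₀ : Model S A H) (h : Fin (H + 1)) : S → ℝ :=
  Fin.reverseInduction (motive := fun _ => S → ℝ) (fun _ => 0)
    (fun h V s => ⨆ a : A, robustQ p ρ r P₀ h V s a) h

/-- `π` is an output of Robust Phased Value Learning on the data `D`: at every step and state it
picks a maximizer (with any tie-breaking) in the robust backward induction for the empirical
model. -/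
def IsOutput [Fintype S] [MetricSpace S] (p ρ : ℝ) (r : Fin H → S → A → ℝ)
    (D : Fin H → S → A → Fin N → S) (π : Policy S A H) : Prop :=
  ∀ h s a,
    robustQ p ρ r (empiricalModel D) h (robustDP p ρ r (empiricalModel D) h.succ) s a ≤
      robustQ p ρ r (empiricalModel D) h (robustDP p ρ r (empiricalModel D) h.succ) s (π h s)

/-- The sample size `N_W` of the bound; `nS`, `nA` are the numbers of states and actions and `B`
is `B_p`. -/
def sampleBound (H nS nA B p ρ δ ε : ℝ) : ℝ :=
  8 * H ^ 5 * nS * nA * (B + ρ ^ p) ^ 2 / (ρ ^ (2 * p) * ε ^ 2) *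
    Real.log (16 * H ^ 2 * nS * nA * (H * B + max H (ρ ^ p)) / (ρ ^ p * δ * ε))

end RPVL

end

/-!
By Lagrangian duality, the worst case of `V` over a Wasserstein ball around `P` is the maximum over
a multiplier `l` of `∑ y, P y * V_l y - l * ρ ^ p`, where `V_l y = min_x (V x + l * d(x, y) ^ p)`.
Transporting nothing costs `0 < ρ ^ p`, and this Slater point confines `l` to `[0, H / ρ ^ p]` when
`V` takes values in `[0, H]`. So the worst cases around two centres differ by no more than the
ordinary expectations of the functions `V_l`, and since these are Lipschitz in `l`, finitely many
values of `l` suffice up to a discretization error.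

The estimated value at step `h + 1` is computed from the samples of later steps only, so it is
independent of those of step `h`; conditionally on it, Hoeffding's inequality applies to each `V_l`
on the grid, and a union bound covers all steps, states, actions and grid points. On the resulting
event every one-step worst case under the empirical model is off by at most `η`, and these errors
add up to at most `H * η` for the computed value of the optimal policy and for that of the output.
-/

noncomputable section

namespace RPVL

theorem slope_le_slope_of_feasible {E : Type*} [AddCommGroup E] [Module ℝ E] {C : Set E}
    {v c : E → ℝ} (hv : ConvexOn ℝ C v) (hc : ConvexOn ℝ C c) {v₀ κ : ℝ}
    (hopt : ∀ x ∈ C, c x ≤ κ → v₀ ≤ v x) {x y : E} (hx : x ∈ C) (hy : y ∈ C) (hxκ : c x < κ)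
    (hyκ : κ < c y) : (v₀ - v y) / (c y - κ) ≤ (v x - v₀) / (κ - c x) := by
  have hd : 0 < c y - c x := by linarith
  set a := (c y - κ) / (c y - c x) with ha
  set b := (κ - c x) / (c y - c x) with hb
  have ha0 : 0 ≤ a := div_nonneg (by linarith) hd.le
  have hb0 : 0 ≤ b := div_nonneg (by linarith) hd.le
  have hab : a + b = 1 := by rw [ha, hb, ← add_div, div_eq_one_iff_eq hd.ne']; ring
  have hcκ : c (a • x + b • y) ≤ κ :=
    (hc.2 hx hy ha0 hb0 hab).trans_eq (by simp only [smul_eq_mul, ha, hb]; field_simp; ring)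
  have hv₀ := (hopt _ (hv.1 hx hy ha0 hb0 hab) hcκ).trans (hv.2 hx hy ha0 hb0 hab)
  simp only [smul_eq_mul, ha, hb] at hv₀
  rw [div_mul_eq_mul_div, div_mul_eq_mul_div, ← add_div, le_div_iff₀ hd] at hv₀
  rw [div_le_div_iff₀ (by linarith) (by linarith)]
  linarith

theorem exists_lagrange_multiplier {E : Type*} [AddCommGroup E] [Module ℝ E] {C : Set E}
    {v c : E → ℝ} (hv : ConvexOn ℝ C v) (hc : ConvexOn ℝ C c) {v₀ κ : ℝ}
    (hopt : ∀ x ∈ C, c x ≤ κ → v₀ ≤ v x) {x₀ : E} (hx₀ : x₀ ∈ C) (hslater : c x₀ < κ) :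
    ∃ l ∈ Set.Icc 0 ((v x₀ - v₀) / (κ - c x₀)), ∀ x ∈ C, v₀ ≤ v x + l * (c x - κ) := by
  -- Feasible points bound the multiplier from above, infeasible ones from below; convexity on the
  -- segment between the two makes these bounds compatible.
  set lower : Set ℝ := insert 0 {t | ∃ y ∈ C, κ < c y ∧ (v₀ - v y) / (c y - κ) = t}
  set upper : Set ℝ := {t | ∃ x ∈ C, c x < κ ∧ (v x - v₀) / (κ - c x) = t}
  have hcompat : ∀ t ∈ lower, ∀ u ∈ upper, t ≤ u := by
    rintro _ (rfl | ⟨y, hy, hyκ, rfl⟩) _ ⟨x, hx, hxκ, rfl⟩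
    · exact div_nonneg (sub_nonneg.2 (hopt x hx hxκ.le)) (sub_nonneg.2 hxκ.le)
    · exact slope_le_slope_of_feasible hv hc hopt hx hy hxκ hyκ
  have hupper : upper.Nonempty := ⟨_, x₀, hx₀, hslater, rfl⟩
  obtain ⟨l, hl_lower, hl_upper⟩ :=
    exists_between_of_forall_le (Set.insert_nonempty _ _) hupper hcompat
  refine ⟨l, ⟨hl_lower (Set.mem_insert _ _), hl_upper ⟨x₀, hx₀, hslater, rfl⟩⟩, fun x hx => ?_⟩
  rcases lt_trichotomy (c x) κ with h | h | h
  · have := hl_upper ⟨x, hx, h, rfl⟩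
    rw [le_div_iff₀ (sub_pos.2 h)] at this
    linarith
  · simpa [h] using hopt x hx h.le
  · have := hl_lower (Or.inr ⟨x, hx, h, rfl⟩)
    rw [div_le_iff₀ (sub_pos.2 h)] at this
    linarith

section Simplex

variable {X Y : Type*} [Fintype X] [Fintype Y]

theorem sum_mul_mono_of_mem_stdSimplex {P V W : X → ℝ} (hP : P ∈ stdSimplex ℝ X)
    (hVW : ∀ x, V x ≤ W x) : ∑ x, P x * V x ≤ ∑ x, P x * W x :=
  Finset.sum_le_sum fun x _ => mul_le_mul_of_nonneg_left (hVW x) (hP.1 x)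

theorem sum_mul_add_const_of_mem_stdSimplex {P : X → ℝ} (hP : P ∈ stdSimplex ℝ X) (V : X → ℝ)
    (c : ℝ) : ∑ x, P x * (V x + c) = ∑ x, P x * V x + c := by
  simp only [mul_add, Finset.sum_add_distrib, ← Finset.sum_mul, hP.2, one_mul]

theorem sum_mul_mem_Icc_of_mem_stdSimplex {P V : X → ℝ} {a b : ℝ} (hP : P ∈ stdSimplex ℝ X)
    (hV : ∀ x, V x ∈ Set.Icc a b) : ∑ x, P x * V x ∈ Set.Icc a b := by
  have hconst (c : ℝ) : ∑ x, P x * c = c := by rw [← Finset.sum_mul, hP.2, one_mul]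
  rw [← hconst a, ← hconst b]
  exact ⟨sum_mul_mono_of_mem_stdSimplex hP fun x => (hV x).1,
    sum_mul_mono_of_mem_stdSimplex hP fun x => (hV x).2⟩

theorem convexOn_sum_mul {C : Set (X → ℝ)} (hC : Convex ℝ C) (f : X → ℝ) :
    ConvexOn ℝ C fun ν => ∑ x, f x * ν x := by
  refine ⟨hC, fun ν _ ν' _ a b _ _ _ => le_of_eq ?_⟩
  simp only [Pi.add_apply, Pi.smul_apply, smul_eq_mul, mul_add, Finset.sum_add_distrib,
    Finset.mul_sum, mul_left_comm (f _)]

theorem marginal_mem_stdSimplex {ν : X × Y → ℝ} (hν : ν ∈ stdSimplex ℝ (X × Y)) :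
    (fun x => ∑ y, ν (x, y)) ∈ stdSimplex ℝ X :=
  ⟨fun x => Finset.sum_nonneg fun y _ => hν.1 (x, y), by
    rw [← Fintype.sum_prod_type]; exact hν.2⟩

end Simplex

section Transport

variable {X Y : Type*}

/-- The transport plans into `P`: the probability vectors on `X × Y` with second marginal `P`.
The first marginal is free, since the ball around `P` is swept out by it. -/
def transportPlans (X : Type*) [Fintype X] [Fintype Y] (P : Y → ℝ) : Set (X × Y → ℝ) :=
  {ν | ν ∈ stdSimplex ℝ (X × Y) ∧ ∀ y, ∑ x, ν (x, y) = P y}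

open Classical in
/-- The transport plan induced by a map: the law of `(T y, y)` when `y` has law `P`. -/
def graphPlan (T : Y → X) (P : Y → ℝ) : X × Y → ℝ :=
  fun z => if z.1 = T z.2 then P z.2 else 0

/-- The `c`-transform of `V` for the cost `l * c`, the integrand of the Kantorovich dual of the
worst case of `V`. -/
def cTransform (c : X → Y → ℝ) (V : X → ℝ) (l : ℝ) (y : Y) : ℝ := ⨅ x, (V x + l * c x y)

section Plans

variable [Fintype X] [Fintype Y]

theorem convex_transportPlans (P : Y → ℝ) : Convex ℝ (transportPlans X P) := by
  rintro ν ⟨hν, hνP⟩ ν' ⟨hν', hνP'⟩ a b ha hb hab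
  refine ⟨convex_stdSimplex ℝ _ hν hν' ha hb hab, fun y => ?_⟩
  simp only [Pi.add_apply, Pi.smul_apply, smul_eq_mul, Finset.sum_add_distrib,
    ← Finset.mul_sum, hνP, hνP', ← add_mul, hab, one_mul]

theorem sum_mul_graphPlan (T : Y → X) (P : Y → ℝ) (f : X × Y → ℝ) :
    ∑ z, f z * graphPlan T P z = ∑ y, P y * f (T y, y) := by
  classical
  simp [Fintype.sum_prod_type_right, graphPlan, mul_comm]

theorem graphPlan_mem_transportPlans (T : Y → X) {P : Y → ℝ} (hP : P ∈ stdSimplex ℝ Y) :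
    graphPlan T P ∈ transportPlans X P := by
  classical
  refine ⟨⟨fun z => ?_, ?_⟩, fun y => by simp [graphPlan]⟩
  · rw [graphPlan]
    split_ifs
    exacts [hP.1 _, le_rfl]
  · simpa [hP.2] using sum_mul_graphPlan T P fun _ => 1

end Plans

theorem cTransform_le [Finite X] (c : X → Y → ℝ) (V : X → ℝ) (l : ℝ) (x : X) (y : Y) :
    cTransform c V l y ≤ V x + l * c x y :=
  ciInf_le (Set.finite_range _).bddBelow x

theorem measurable_cTransform [Finite X] (c : X → Y → ℝ) (l : ℝ) :
    Measurable fun V : X → ℝ => cTransform c V l :=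
  measurable_pi_iff.2 fun _ => Measurable.iInf fun _ => by fun_prop

variable [Finite X] [Nonempty X]

theorem exists_eq_cTransform (c : X → Y → ℝ) (V : X → ℝ) (l : ℝ) (y : Y) :
    ∃ x, V x + l * c x y = cTransform c V l y :=
  exists_eq_ciInf_of_finite

theorem cTransform_mem_Icc {c : X → Y → ℝ} {y : Y} (hc : ∀ x, 0 ≤ c x y)
    (hzero : ∃ x, c x y = 0) {V : X → ℝ} {a b : ℝ} (hV : ∀ x, V x ∈ Set.Icc a b) {l : ℝ}
    (hl : 0 ≤ l) : cTransform c V l y ∈ Set.Icc a b := by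
  obtain ⟨x, hx⟩ := hzero
  refine ⟨le_ciInf fun x' => ?_, (cTransform_le c V l x y).trans ?_⟩
  · exact (hV x').1.trans (le_add_of_nonneg_right (mul_nonneg hl (hc x')))
  · simpa [hx] using (hV x).2

theorem cTransform_mem_Icc_of_le {c : X → Y → ℝ} {y : Y} {B : ℝ}
    (hc : ∀ x, c x y ∈ Set.Icc 0 B) (V : X → ℝ) {l m : ℝ} (hml : m ≤ l) :
    cTransform c V l y ∈ Set.Icc (cTransform c V m y) (cTransform c V m y + (l - m) * B) := by
  constructor
  · obtain ⟨x, hx⟩ := exists_eq_cTransform c V l y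
    rw [← hx]
    exact (cTransform_le c V m x y).trans (by gcongr; exact (hc x).1)
  · obtain ⟨x, hx⟩ := exists_eq_cTransform c V m y
    have hcB := mul_le_mul_of_nonneg_left (hc x).2 (sub_nonneg.2 hml)
    linarith [cTransform_le c V l x y]

variable [Fintype Y]

theorem sum_mul_cTransform_mem_Icc {c : X → Y → ℝ} {B : ℝ} (hc : ∀ x y, c x y ∈ Set.Icc 0 B)
    (V : X → ℝ) {P : Y → ℝ} (hP : P ∈ stdSimplex ℝ Y) {l m : ℝ} (hml : m ≤ l) :
    ∑ y, P y * cTransform c V l y ∈ Set.Icc (∑ y, P y * cTransform c V m y)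
      (∑ y, P y * cTransform c V m y + (l - m) * B) := by
  have hmem y := cTransform_mem_Icc_of_le (fun x => hc x y) V hml
  rw [← sum_mul_add_const_of_mem_stdSimplex hP]
  exact ⟨sum_mul_mono_of_mem_stdSimplex hP fun y => (hmem y).1,
    sum_mul_mono_of_mem_stdSimplex hP fun y => (hmem y).2⟩

theorem exists_nat_lt_mem_Icc_mul {θ Λ : ℝ} (hθ : 0 < θ) {G : ℕ} (hG : Λ < θ * G) {l : ℝ}
    (hl : l ∈ Set.Icc 0 Λ) : ∃ j < G, l ∈ Set.Icc (θ * j) (θ * j + θ) := by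
  have hfloor := Nat.floor_le (div_nonneg hl.1 hθ.le)
  rw [le_div_iff₀' hθ] at hfloor
  refine ⟨⌊l / θ⌋₊, ?_, hfloor, ?_⟩
  · exact_mod_cast lt_of_mul_lt_mul_left (hfloor.trans_lt (hl.2.trans_lt hG)) hθ.le
  · have := (Nat.lt_floor_add_one (l / θ)).le
    rwa [div_le_iff₀' hθ, mul_add, mul_one] at this

theorem abs_sum_mul_cTransform_sub_le_of_grid {c : X → Y → ℝ} {B : ℝ} (hB : 0 ≤ B)
    (hc : ∀ x y, c x y ∈ Set.Icc 0 B) (V : X → ℝ) {P Q : Y → ℝ} (hP : P ∈ stdSimplex ℝ Y)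
    (hQ : Q ∈ stdSimplex ℝ Y) {θ Λ t : ℝ} (hθ : 0 < θ) {G : ℕ} (hG : Λ < θ * G)
    (hgrid : ∀ j < G, |∑ y, P y * cTransform c V (θ * j) y -
      ∑ y, Q y * cTransform c V (θ * j) y| ≤ t) {l : ℝ} (hl : l ∈ Set.Icc 0 Λ) :
    |∑ y, P y * cTransform c V l y - ∑ y, Q y * cTransform c V l y| ≤ t + θ * B := by
  obtain ⟨j, hjG, hjl, hlj⟩ := exists_nat_lt_mem_Icc_mul hθ hG hl
  have hP_mem := sum_mul_cTransform_mem_Icc hc V hP hjl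
  have hQ_mem := sum_mul_cTransform_mem_Icc hc V hQ hjl
  have hmesh : (l - θ * j) * B ≤ θ * B := mul_le_mul_of_nonneg_right (by linarith) hB
  have hj := abs_le.1 (hgrid j hjG)
  exact abs_le.2 ⟨by linarith [hP_mem.1, hQ_mem.2], by linarith [hP_mem.2, hQ_mem.1]⟩

end Transport

section Duality

variable {X Y : Type*} [Fintype X] [Fintype Y]

theorem sum_mul_cTransform_le (c : X → Y → ℝ) (V : X → ℝ) (l : ℝ) {P : Y → ℝ} {ν : X × Y → ℝ}
    (hν : ν ∈ transportPlans X P) :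
    ∑ y, P y * cTransform c V l y ≤ ∑ z, V z.1 * ν z + l * ∑ z, c z.1 z.2 * ν z := by
  calc ∑ y, P y * cTransform c V l y = ∑ z : X × Y, ν z * cTransform c V l z.2 := by
        simp_rw [Fintype.sum_prod_type_right, ← Finset.sum_mul, hν.2]
    _ ≤ ∑ z : X × Y, ν z * (V z.1 + l * c z.1 z.2) :=
        sum_mul_mono_of_mem_stdSimplex hν.1 fun z => cTransform_le c V l z.1 z.2
    _ = ∑ z, V z.1 * ν z + l * ∑ z, c z.1 z.2 * ν z := by
        rw [Finset.mul_sum, ← Finset.sum_add_distrib]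
        exact Finset.sum_congr rfl fun z _ => by ring

/-- The map `T₀` transports at no cost and so provides the Slater point that bounds the
multiplier. -/
theorem exists_le_sum_mul_cTransform [Nonempty X] {c : X → Y → ℝ} {T₀ : Y → X}
    (hT₀ : ∀ y, c (T₀ y) y = 0) {P : Y → ℝ} (hP : P ∈ stdSimplex ℝ Y) {V : X → ℝ} {v₀ κ : ℝ}
    (hκ : 0 < κ) (hopt : ∀ ν ∈ transportPlans X P, ∑ z, c z.1 z.2 * ν z ≤ κ →
      v₀ ≤ ∑ z, V z.1 * ν z) :
    ∃ l ∈ Set.Icc 0 ((∑ y, P y * V (T₀ y) - v₀) / κ),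
      v₀ ≤ ∑ y, P y * cTransform c V l y - l * κ := by
  have hfree : ∑ z, c z.1 z.2 * graphPlan T₀ P z = 0 := by
    simp [sum_mul_graphPlan, hT₀]
  obtain ⟨l, hl, hle⟩ := exists_lagrange_multiplier
    (convexOn_sum_mul (convex_transportPlans P) fun z => V z.1)
    (convexOn_sum_mul (convex_transportPlans P) fun z => c z.1 z.2) hopt
    (graphPlan_mem_transportPlans T₀ hP) (hfree.trans_lt hκ)
  choose T hT using exists_eq_cTransform c V l
  refine ⟨l, ?_, (hle _ (graphPlan_mem_transportPlans T hP)).trans_eq ?_⟩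
  · simpa only [hfree, sum_mul_graphPlan, sub_zero] using hl
  · simp only [sum_mul_graphPlan, ← hT, mul_add, Finset.sum_add_distrib, mul_sub, Finset.mul_sum,
      mul_left_comm l, add_sub_assoc]

end Duality

section Wasserstein

variable {S : Type*}

/-- The transport cost `d(x, y) ^ p` of the `p`-Wasserstein distance, in curried form. -/
def distPow [MetricSpace S] (p : ℝ) (x y : S) : ℝ := dist x y ^ p

theorem distPow_self [MetricSpace S] {p : ℝ} (hp : 0 < p) (x : S) : distPow p x x = 0 := by
  rw [distPow, dist_self, Real.zero_rpow hp.ne']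

theorem distPow_nonneg [MetricSpace S] (p : ℝ) (x y : S) : 0 ≤ distPow p x y :=
  Real.rpow_nonneg dist_nonneg p

theorem maxDistPow_nonneg (S : Type*) [MetricSpace S] (p : ℝ) : 0 ≤ maxDistPow S p :=
  Real.iSup_nonneg fun z => distPow_nonneg p z.1 z.2

theorem distPow_mem_Icc [Finite S] [MetricSpace S] (p : ℝ) (x y : S) :
    distPow p x y ∈ Set.Icc 0 (maxDistPow S p) :=
  ⟨distPow_nonneg p x y,
    le_ciSup (f := fun z : S × S => dist z.1 z.2 ^ p) (Set.finite_range _).bddAbove (x, y)⟩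

variable [Fintype S]

theorem bddBelow_image_sum_mul {K : Set (S → ℝ)} (hK : K ⊆ stdSimplex ℝ S) (V : S → ℝ) :
    BddBelow ((fun P : S → ℝ => ∑ s, P s * V s) '' K) :=
  ((isCompact_stdSimplex ℝ S).image (by fun_prop)).bddBelow.mono (Set.image_mono hK)

theorem worstCase_le {K : Set (S → ℝ)} (hK : K ⊆ stdSimplex ℝ S) (V : S → ℝ) {P : S → ℝ}
    (hP : P ∈ K) : worstCase K V ≤ ∑ s, P s * V s :=
  csInf_le (bddBelow_image_sum_mul hK V) ⟨P, hP, rfl⟩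

theorem exists_lt_worstCase_add {K : Set (S → ℝ)} (hK : K.Nonempty) (V : S → ℝ) {ξ : ℝ}
    (hξ : 0 < ξ) : ∃ P ∈ K, ∑ s, P s * V s < worstCase K V + ξ := by
  obtain ⟨_, ⟨P, hP, rfl⟩, hlt⟩ := Real.lt_sInf_add_pos (hK.image fun P => ∑ s, P s * V s) hξ
  exact ⟨P, hP, hlt⟩

theorem worstCase_mem_Icc {K : Set (S → ℝ)} (hK : K ⊆ stdSimplex ℝ S) (hne : K.Nonempty)
    {V : S → ℝ} {a b : ℝ} (hV : ∀ s, V s ∈ Set.Icc a b) : worstCase K V ∈ Set.Icc a b := by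
  obtain ⟨P, hP⟩ := hne
  refine ⟨le_csInf (Set.Nonempty.image _ ⟨P, hP⟩) ?_, (worstCase_le hK V hP).trans ?_⟩
  · rintro _ ⟨Q, hQ, rfl⟩
    exact (sum_mul_mem_Icc_of_mem_stdSimplex (hK hQ) hV).1
  · exact (sum_mul_mem_Icc_of_mem_stdSimplex (hK hP) hV).2

theorem isCoupling_mul {P Q : S → ℝ} (hP : P ∈ stdSimplex ℝ S) (hQ : Q ∈ stdSimplex ℝ S) :
    IsCoupling (fun z => P z.1 * Q z.2) P Q := by
  refine ⟨⟨fun z => mul_nonneg (hP.1 _) (hQ.1 _), ?_⟩, fun x => ?_, fun y => ?_⟩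
  · rw [Fintype.sum_prod_type, ← Fintype.sum_mul_sum, hP.2, hQ.2, one_mul]
  · simp only [← Finset.mul_sum, hQ.2, mul_one]
  · simp only [← Finset.sum_mul, hP.2, one_mul]

theorem IsCoupling.mem_transportPlans {ν : S × S → ℝ} {P Q : S → ℝ} (hν : IsCoupling ν P Q) :
    ν ∈ transportPlans S Q :=
  ⟨hν.1, hν.2.2⟩

variable [MetricSpace S] {p ρ : ℝ}

theorem wassersteinBall_subset (p ρ : ℝ) (P : S → ℝ) : wassersteinBall p ρ P ⊆ stdSimplex ℝ S :=
  fun _ h => h.1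

theorem zero_mem_lowerBounds_couplingCosts (p : ℝ) (P Q : S → ℝ) :
    0 ∈ lowerBounds {c : ℝ | ∃ ν, IsCoupling ν P Q ∧ c = ∑ z, dist z.1 z.2 ^ p * ν z} := by
  rintro _ ⟨ν, hν, rfl⟩
  exact Finset.sum_nonneg fun z _ => mul_nonneg (distPow_nonneg p _ _) (hν.1.1 z)

theorem transportCost_le (p : ℝ) {P Q : S → ℝ} {ν : S × S → ℝ} (hν : IsCoupling ν P Q) :
    transportCost p P Q ≤ ∑ z, distPow p z.1 z.2 * ν z :=
  csInf_le ⟨0, zero_mem_lowerBounds_couplingCosts p P Q⟩ ⟨ν, hν, rfl⟩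

theorem wasserstein_le_iff (hp : 0 < p) (hρ : 0 ≤ ρ) (P Q : S → ℝ) :
    wasserstein p P Q ≤ ρ ↔ transportCost p P Q ≤ ρ ^ p := by
  have hcost : 0 ≤ transportCost p P Q :=
    Real.sInf_nonneg (zero_mem_lowerBounds_couplingCosts p P Q)
  rw [wasserstein, one_div, Real.rpow_inv_le_iff_of_pos hcost hρ hp]

theorem fst_mem_wassersteinBall (hp : 0 < p) (hρ : 0 ≤ ρ) {P : S → ℝ} {ν : S × S → ℝ}
    (hν : ν ∈ transportPlans S P) (hcost : ∑ z, distPow p z.1 z.2 * ν z ≤ ρ ^ p) :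
    (fun x => ∑ y, ν (x, y)) ∈ wassersteinBall p ρ P :=
  ⟨marginal_mem_stdSimplex hν.1, (wasserstein_le_iff hp hρ _ _).2 <|
    (transportCost_le p ⟨hν.1, fun _ => rfl, hν.2⟩).trans hcost⟩

theorem wassersteinBall_nonempty (hp : 0 < p) (hρ : 0 ≤ ρ) {P : S → ℝ}
    (hP : P ∈ stdSimplex ℝ S) : (wassersteinBall p ρ P).Nonempty := by
  refine ⟨_, fst_mem_wassersteinBall hp hρ (graphPlan_mem_transportPlans id hP) ?_⟩
  simpa [sum_mul_graphPlan, distPow_self hp] using Real.rpow_nonneg hρ p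

theorem sum_mul_cTransform_le_add_transportCost (p : ℝ) {P Q : S → ℝ}
    (hP : P ∈ stdSimplex ℝ S) (hQ : Q ∈ stdSimplex ℝ S) (V : S → ℝ) {l : ℝ} (hl : 0 ≤ l) :
    ∑ y, P y * cTransform (distPow p) V l y ≤
      ∑ x, Q x * V x + l * transportCost p Q P := by
  rw [← sub_le_iff_le_add', ← smul_eq_mul, transportCost, ← Real.sInf_smul_of_nonneg hl]
  refine le_csInf (Set.Nonempty.smul_set ⟨_, _, isCoupling_mul hQ hP, rfl⟩) ?_
  rintro _ ⟨_, ⟨ν, hν, rfl⟩, rfl⟩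
  have hQV : ∑ x, Q x * V x = ∑ z, V z.1 * ν z := by
    simp_rw [Fintype.sum_prod_type, ← Finset.mul_sum, hν.2.1, mul_comm]
  rw [sub_le_iff_le_add', hQV]
  exact sum_mul_cTransform_le (distPow p) V l hν.mem_transportPlans

/-- The Lagrange dual function of the worst case of `V` over the Wasserstein ball of radius `ρ`
around `P`; the scalar `l` is the multiplier of the constraint on the transport cost. -/
def dualObjective (p ρ : ℝ) (P V : S → ℝ) (l : ℝ) : ℝ :=
  ∑ y, P y * cTransform (distPow p) V l y - l * ρ ^ p

theorem dualObjective_le_worstCase (hp : 0 < p) (hρ : 0 ≤ ρ) {P : S → ℝ}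
    (hP : P ∈ stdSimplex ℝ S) (V : S → ℝ) {l : ℝ} (hl : 0 ≤ l) :
    dualObjective p ρ P V l ≤ worstCase (wassersteinBall p ρ P) V := by
  refine le_csInf ((wassersteinBall_nonempty hp hρ hP).image _) ?_
  rintro _ ⟨Q, ⟨hQ, hQP⟩, rfl⟩
  rw [wasserstein_le_iff hp hρ] at hQP
  exact sub_le_iff_le_add.2 <| (sum_mul_cTransform_le_add_transportCost p hP hQ V hl).trans <| by
    gcongr

variable [Nonempty S]

theorem exists_worstCase_le_dualObjective (hp : 0 < p) (hρ : 0 < ρ) {P : S → ℝ}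
    (hP : P ∈ stdSimplex ℝ S) {V : S → ℝ} {a b : ℝ} (hV : ∀ s, V s ∈ Set.Icc a b) :
    ∃ l ∈ Set.Icc 0 ((b - a) / ρ ^ p),
      worstCase (wassersteinBall p ρ P) V ≤ dualObjective p ρ P V l := by
  have hball := wassersteinBall_subset p ρ P
  obtain ⟨l, hl, hle⟩ := exists_le_sum_mul_cTransform (T₀ := id) (distPow_self hp) hP
    (V := V) (Real.rpow_pos_of_pos hρ p) fun ν hν hcost =>
      (worstCase_le hball V (fst_mem_wassersteinBall hp hρ.le hν hcost)).trans_eq <| by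
        simp_rw [Fintype.sum_prod_type, ← Finset.mul_sum, mul_comm]
  refine ⟨l, ⟨hl.1, hl.2.trans ?_⟩, hle⟩
  gcongr
  · exact (sum_mul_mem_Icc_of_mem_stdSimplex hP hV).2
  · exact (worstCase_mem_Icc hball (wassersteinBall_nonempty hp hρ.le hP) hV).1

theorem isGreatest_dualObjective_worstCase (hp : 0 < p) (hρ : 0 < ρ) {P : S → ℝ}
    (hP : P ∈ stdSimplex ℝ S) {V : S → ℝ} {a b : ℝ} (hV : ∀ s, V s ∈ Set.Icc a b) :
    IsGreatest (dualObjective p ρ P V '' Set.Icc 0 ((b - a) / ρ ^ p))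
      (worstCase (wassersteinBall p ρ P) V) := by
  constructor
  · obtain ⟨l, hl, hle⟩ := exists_worstCase_le_dualObjective hp hρ hP hV
    exact ⟨l, hl, (dualObjective_le_worstCase hp hρ.le hP V hl.1).antisymm hle⟩
  · rintro _ ⟨l, hl, rfl⟩
    exact dualObjective_le_worstCase hp hρ.le hP V hl.1

theorem abs_worstCase_sub_le (hp : 0 < p) (hρ : 0 < ρ) {P Q : S → ℝ} (hP : P ∈ stdSimplex ℝ S)
    (hQ : Q ∈ stdSimplex ℝ S) {V : S → ℝ} {a b η : ℝ} (hV : ∀ s, V s ∈ Set.Icc a b)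
    (hη : ∀ l ∈ Set.Icc 0 ((b - a) / ρ ^ p), |∑ y, P y * cTransform (distPow p) V l y -
      ∑ y, Q y * cTransform (distPow p) V l y| ≤ η) :
    |worstCase (wassersteinBall p ρ P) V - worstCase (wassersteinBall p ρ Q) V| ≤ η := by
  have hPmax := isGreatest_dualObjective_worstCase hp hρ hP hV
  have hQmax := isGreatest_dualObjective_worstCase hp hρ hQ hV
  obtain ⟨l, hl, hPl⟩ := hPmax.1
  obtain ⟨m, hm, hQm⟩ := hQmax.1
  have hle_l := hQmax.2 ⟨l, hl, rfl⟩
  have hle_m := hPmax.2 ⟨m, hm, rfl⟩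
  have hη_l := abs_le.1 (hη l hl)
  have hη_m := abs_le.1 (hη m hm)
  simp only [dualObjective] at hPl hQm hle_l hle_m
  exact abs_le.2 ⟨by linarith, by linarith⟩

theorem abs_worstCase_sub_le_of_grid (hp : 0 < p) (hρ : 0 < ρ) {P Q : S → ℝ}
    (hP : P ∈ stdSimplex ℝ S) (hQ : Q ∈ stdSimplex ℝ S) {V : S → ℝ} {a b θ t : ℝ}
    (hV : ∀ s, V s ∈ Set.Icc a b) (hθ : 0 < θ) {G : ℕ} (hG : (b - a) / ρ ^ p < θ * G)
    (hgrid : ∀ j < G, |∑ y, P y * cTransform (distPow p) V (θ * j) y -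
      ∑ y, Q y * cTransform (distPow p) V (θ * j) y| ≤ t) :
    |worstCase (wassersteinBall p ρ P) V - worstCase (wassersteinBall p ρ Q) V| ≤
      t + θ * maxDistPow S p :=
  abs_worstCase_sub_le hp hρ hP hQ hV fun _ =>
    abs_sum_mul_cTransform_sub_le_of_grid (maxDistPow_nonneg S p) (distPow_mem_Icc p) V hP hQ hθ
      hG hgrid

end Wasserstein

section Value

variable {S A : Type*} {H : ℕ}

theorem trajProb_cons_cons (P : Model S A (H + 1)) (π : Policy S A (H + 1)) (s s' : S)
    (y : Fin H → S) :
    trajProb P π (Fin.cons s (Fin.cons s' y : Fin (H + 1) → S)) =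
      P 0 s (π 0 s) s' * trajProb (fun h => P h.succ) (fun h => π h.succ) (Fin.cons s' y) := by
  simp [trajProb, Fin.prod_univ_succ (n := H)]

theorem totalReward_cons (r : Fin (H + 1) → S → A → ℝ) (π : Policy S A (H + 1)) (s : S)
    (y : Fin (H + 1) → S) :
    totalReward r π (Fin.cons s y) =
      r 0 s (π 0 s) + totalReward (fun h => r h.succ) (fun h => π h.succ) y := by
  simp [totalReward, Fin.sum_univ_succ (n := H)]

variable [Fintype S]

theorem sum_pi_fin_succ (F : (Fin (H + 1) → S) → ℝ) :
    ∑ y, F y = ∑ s, ∑ y : Fin H → S, F (Fin.cons s y) := by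
  rw [← Fintype.sum_prod_type', ← (Fin.consEquiv fun _ : Fin (H + 1) => S).sum_comp]
  rfl

theorem sum_trajProb {P : Model S A H} (hP : ∀ h s a, P h s a ∈ stdSimplex ℝ S)
    (π : Policy S A H) (s : S) :
    ∑ y : Fin H → S, trajProb P π (Fin.cons s y : Fin (H + 1) → S) = 1 := by
  induction H generalizing s with
  | zero => simp [trajProb]
  | succ H ih =>
    have hsucc := ih (P := fun h => P h.succ) (fun h => hP h.succ) fun h => π h.succ
    simp_rw [sum_pi_fin_succ, trajProb_cons_cons, ← Finset.mul_sum, hsucc, mul_one]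
    exact (hP 0 s (π 0 s)).2

theorem value_zero (r : Fin 0 → S → A → ℝ) (P : Model S A 0) (π : Policy S A 0) (s : S) :
    value r P π s = 0 := by
  simp [value, totalReward]

theorem value_succ (r : Fin (H + 1) → S → A → ℝ) {P : Model S A (H + 1)}
    (hP : ∀ h s a, P h s a ∈ stdSimplex ℝ S) (π : Policy S A (H + 1)) (s : S) :
    value r P π s = r 0 s (π 0 s) + ∑ s', P 0 s (π 0 s) s' *
      value (fun h => r h.succ) (fun h => P h.succ) (fun h => π h.succ) s' := by
  simp_rw [value, totalReward_cons, mul_add, Finset.sum_add_distrib, ← Finset.sum_mul,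
    sum_trajProb hP, one_mul, sum_pi_fin_succ, trajProb_cons_cons, Finset.mul_sum, mul_assoc]

theorem value_neg (r : Fin H → S → A → ℝ) (P : Model S A H) (π : Policy S A H) (s : S) :
    value (fun h s a => -r h s a) P π s = -value r P π s := by
  simp [value, totalReward]

theorem value_le_of_step {r : Fin H → S → A → ℝ} {P : Model S A H}
    (hP : ∀ h s a, P h s a ∈ stdSimplex ℝ S) {π : Policy S A H} {V : Fin (H + 1) → S → ℝ}
    {c : ℝ} (hlast : ∀ s, 0 ≤ V (Fin.last H) s)
    (hstep : ∀ h s, r h s (π h s) + ∑ s', P h s (π h s) s' * V h.succ s' ≤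
      V h.castSucc s + c) (s : S) :
    value r P π s ≤ V 0 s + H * c := by
  induction H generalizing s with
  | zero => simpa [value_zero] using hlast s
  | succ H ih =>
    have hsucc := sum_mul_mono_of_mem_stdSimplex (hP 0 s (π 0 s)) <|
      ih (r := fun h => r h.succ) (P := fun h => P h.succ) (fun h => hP h.succ)
        (π := fun h => π h.succ) (V := fun k => V k.succ) hlast
        fun h s => by simpa only [Fin.succ_castSucc] using hstep h.succ s
    rw [sum_mul_add_const_of_mem_stdSimplex (hP 0 s (π 0 s))] at hsucc
    have hzero := hstep 0 s
    rw [Fin.castSucc_zero] at hzero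
    rw [value_succ r hP]
    push_cast
    linarith

theorem le_value_of_step {r : Fin H → S → A → ℝ} {P : Model S A H}
    (hP : ∀ h s a, P h s a ∈ stdSimplex ℝ S) {π : Policy S A H} {V : Fin (H + 1) → S → ℝ}
    {c : ℝ} (hlast : ∀ s, V (Fin.last H) s ≤ 0)
    (hstep : ∀ h s, V h.castSucc s ≤
      r h s (π h s) + ∑ s', P h s (π h s) s' * V h.succ s' + c) (s : S) :
    V 0 s - H * c ≤ value r P π s := by
  have hneg := value_le_of_step (r := fun h s a => -r h s a) hP (π := π)
    (V := fun k s => -V k s) (c := c) (fun s => by linarith [hlast s])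
    (fun h s => by simp only [mul_neg, Finset.sum_neg_distrib]; linarith [hstep h s]) s
  rw [value_neg] at hneg
  linarith

theorem bddBelow_image_value (r : Fin H → S → A → ℝ) {K : Set (Model S A H)}
    (hK : ∀ P ∈ K, ∀ h s a, P h s a ∈ stdSimplex ℝ S) (π : Policy S A H) (s : S) :
    BddBelow ((fun P => value r P π s) '' K) := by
  obtain ⟨b, hb⟩ := (Set.finite_range fun z : Fin H × S => r z.1 z.2 (π z.1 z.2)).bddBelow
  refine ⟨0 - H * -b, ?_⟩
  rintro _ ⟨P, hP, rfl⟩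
  refine le_value_of_step (hK P hP) (V := fun _ _ => 0) (fun _ => le_rfl) (fun h s => ?_) s
  simpa using hb ⟨(h, s), rfl⟩

end Value

section DynamicProgramming

variable {S A : Type*} {H : ℕ} [Fintype S] [MetricSpace S] {p ρ : ℝ}

theorem robustValue_le_of_step (hp : 0 < p) (hρ : 0 ≤ ρ) {r : Fin H → S → A → ℝ}
    {P₀ : Model S A H} (hP₀ : ∀ h s a, P₀ h s a ∈ stdSimplex ℝ S) {π : Policy S A H}
    {V : Fin (H + 1) → S → ℝ} {c : ℝ} (hlast : ∀ s, 0 ≤ V (Fin.last H) s)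
    (hstep : ∀ h s, robustQ p ρ r P₀ h (V h.succ) s (π h s) ≤ V h.castSucc s + c) (s : S) :
    robustValue p ρ r P₀ π s ≤ V 0 s + H * c := by
  refine le_of_forall_pos_le_add fun ξ hξ => ?_
  choose P hP hlt using fun h s a => exists_lt_worstCase_add
    (wassersteinBall_nonempty hp hρ (hP₀ h s a)) (V h.succ) (ξ := ξ / (H + 1)) (by positivity)
  have hvalue : value r P π s ≤ V 0 s + H * (c + ξ / (H + 1)) :=
    value_le_of_step (fun h s a => (hP h s a).1) hlast (fun h s => by
      have hQ := hstep h s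
      rw [robustQ] at hQ
      linarith [hlt h s (π h s)]) s
  have hξH : H * (ξ / (H + 1)) ≤ ξ := by
    rw [mul_div_left_comm]
    exact mul_le_of_le_one_right hξ.le (div_le_one_of_le₀ (by linarith) (by positivity))
  have hinf : robustValue p ρ r P₀ π s ≤ value r P π s :=
    csInf_le (bddBelow_image_value r (fun P hP h s a => (hP h s a).1) π s) ⟨P, hP, rfl⟩
  linarith

theorem le_robustValue_of_step (hp : 0 < p) (hρ : 0 ≤ ρ) {r : Fin H → S → A → ℝ}
    {P₀ : Model S A H} (hP₀ : ∀ h s a, P₀ h s a ∈ stdSimplex ℝ S) {π : Policy S A H}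
    {V : Fin (H + 1) → S → ℝ} {c : ℝ} (hlast : ∀ s, V (Fin.last H) s ≤ 0)
    (hstep : ∀ h s, V h.castSucc s ≤ robustQ p ρ r P₀ h (V h.succ) s (π h s) + c) (s : S) :
    V 0 s - H * c ≤ robustValue p ρ r P₀ π s := by
  choose P hP using fun h s a => wassersteinBall_nonempty hp hρ (hP₀ h s a)
  refine le_csInf (Set.Nonempty.image _ ⟨P, hP⟩) ?_
  rintro _ ⟨P', hP', rfl⟩
  refine le_value_of_step (fun h s a => (hP' h s a).1) hlast (fun h s => ?_) s
  have hQ := hstep h s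
  rw [robustQ] at hQ
  linarith [worstCase_le (wassersteinBall_subset p ρ _) (V h.succ) (hP' h s (π h s))]

theorem robustDP_last (p ρ : ℝ) (r : Fin H → S → A → ℝ) (P : Model S A H) :
    robustDP p ρ r P (Fin.last H) = fun _ => 0 :=
  Fin.reverseInduction_last ..

theorem robustDP_castSucc (p ρ : ℝ) (r : Fin H → S → A → ℝ) (P : Model S A H) (h : Fin H) :
    robustDP p ρ r P h.castSucc = fun s => ⨆ a, robustQ p ρ r P h (robustDP p ρ r P h.succ) s a :=
  Fin.reverseInduction_castSucc ..

theorem robustDP_congr (p ρ : ℝ) (r : Fin H → S → A → ℝ) {P Q : Model S A H} {k : Fin (H + 1)}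
    (hPQ : ∀ i : Fin H, k ≤ i.castSucc → P i = Q i) : robustDP p ρ r P k = robustDP p ρ r Q k := by
  induction k using Fin.reverseInduction with
  | last => simp only [robustDP_last]
  | cast i ih =>
    have hsucc := ih fun j hj => hPQ j (i.castSucc_lt_succ.le.trans hj)
    simp only [robustDP_castSucc, robustQ, hsucc, hPQ i le_rfl]

theorem robustQ_le_robustDP_castSucc [Finite A] (p ρ : ℝ) (r : Fin H → S → A → ℝ)
    (P : Model S A H) (h : Fin H) (s : S) (a : A) :
    robustQ p ρ r P h (robustDP p ρ r P h.succ) s a ≤ robustDP p ρ r P h.castSucc s := by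
  rw [robustDP_castSucc]
  exact le_ciSup (f := fun a => robustQ p ρ r P h (robustDP p ρ r P h.succ) s a)
    (Set.finite_range _).bddAbove a

variable [Nonempty A]

theorem robustDP_mem_Icc_sub (hp : 0 < p) (hρ : 0 ≤ ρ) {r : Fin H → S → A → ℝ}
    (hr : ∀ h s a, r h s a ∈ Set.Icc (0 : ℝ) 1) {P : Model S A H}
    (hP : ∀ h s a, P h s a ∈ stdSimplex ℝ S) (k : Fin (H + 1)) (s : S) :
    robustDP p ρ r P k s ∈ Set.Icc (0 : ℝ) (H - k) := by
  induction k using Fin.reverseInduction generalizing s with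
  | last => simp [robustDP_last]
  | cast i ih =>
    have hQ a : robustQ p ρ r P i (robustDP p ρ r P i.succ) s a ∈ Set.Icc (0 : ℝ) (H - i) := by
      have hw := worstCase_mem_Icc (wassersteinBall_subset p ρ (P i s a))
        (wassersteinBall_nonempty hp hρ (hP i s a)) ih
      rw [Fin.val_succ, Nat.cast_succ] at hw
      exact ⟨add_nonneg (hr i s a).1 hw.1, by rw [robustQ]; linarith [(hr i s a).2, hw.2]⟩
    rw [robustDP_castSucc]
    exact ⟨Real.iSup_nonneg fun a => (hQ a).1, ciSup_le fun a => (hQ a).2⟩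

theorem robustDP_mem_Icc (hp : 0 < p) (hρ : 0 ≤ ρ) {r : Fin H → S → A → ℝ}
    (hr : ∀ h s a, r h s a ∈ Set.Icc (0 : ℝ) 1) {P : Model S A H}
    (hP : ∀ h s a, P h s a ∈ stdSimplex ℝ S) (k : Fin (H + 1)) (s : S) :
    robustDP p ρ r P k s ∈ Set.Icc (0 : ℝ) H :=
  Set.Icc_subset_Icc_right (sub_le_self _ (Nat.cast_nonneg _))
    (robustDP_mem_Icc_sub hp hρ hr hP k s)

theorem norm_optRobustValue_sub_le [Finite A] (hp : 0 < p) (hρ : 0 ≤ ρ) {η : ℝ} (hη : 0 ≤ η)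
    {r : Fin H → S → A → ℝ} {P₀ Q : Model S A H} (hP₀ : ∀ h s a, P₀ h s a ∈ stdSimplex ℝ S)
    (hPQ : ∀ h s a, |worstCase (wassersteinBall p ρ (P₀ h s a)) (robustDP p ρ r Q h.succ) -
      worstCase (wassersteinBall p ρ (Q h s a)) (robustDP p ρ r Q h.succ)| ≤ η)
    {π : Policy S A H}
    (hπ : ∀ h s a, robustQ p ρ r Q h (robustDP p ρ r Q h.succ) s a ≤
      robustQ p ρ r Q h (robustDP p ρ r Q h.succ) s (π h s)) :
    ‖optRobustValue p ρ r P₀ - robustValue p ρ r P₀ π‖ ≤ 2 * H * η := by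
  have hupper (σ : Policy S A H) (s : S) :
      robustValue p ρ r P₀ σ s ≤ robustDP p ρ r Q 0 s + H * η := by
    refine robustValue_le_of_step hp hρ hP₀ (fun s => by rw [robustDP_last]) (fun h s => ?_) s
    have hQ := robustQ_le_robustDP_castSucc p ρ r Q h s (σ h s)
    rw [robustQ] at hQ ⊢
    linarith [(abs_le.1 (hPQ h s (σ h s))).2]
  have hlower (s : S) : robustDP p ρ r Q 0 s - H * η ≤ robustValue p ρ r P₀ π s := by
    refine le_robustValue_of_step hp hρ hP₀ (fun s => by rw [robustDP_last]) (fun h s => ?_) s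
    rw [robustDP_castSucc]
    refine (ciSup_le (hπ h s)).trans ?_
    rw [robustQ, robustQ]
    linarith [(abs_le.1 (hPQ h s (π h s))).1]
  rw [pi_norm_le_iff_of_nonneg (by positivity)]
  intro s
  have hopt : robustValue p ρ r P₀ π s ≤ optRobustValue p ρ r P₀ s :=
    le_ciSup (f := fun σ => robustValue p ρ r P₀ σ s) (Set.finite_range _).bddAbove π
  have hopt_upper : optRobustValue p ρ r P₀ s ≤ robustDP p ρ r Q 0 s + H * η :=
    have : Nonempty (Policy S A H) := ⟨π⟩
    ciSup_le fun σ => hupper σ s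
  rw [Pi.sub_apply, Real.norm_of_nonneg (sub_nonneg.2 hopt)]
  linarith [hlower s]

theorem norm_optRobustValue_sub_le_of_grid [Finite A] [Nonempty S] (hp : 0 < p) (hρ : 0 < ρ)
    {r : Fin H → S → A → ℝ} (hr : ∀ h s a, r h s a ∈ Set.Icc (0 : ℝ) 1) {P₀ Q : Model S A H}
    (hP₀ : ∀ h s a, P₀ h s a ∈ stdSimplex ℝ S) (hQ : ∀ h s a, Q h s a ∈ stdSimplex ℝ S)
    {θ t : ℝ} (hθ : 0 < θ) (ht : 0 ≤ t) {G : ℕ} (hG : H / ρ ^ p < θ * G)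
    (hgrid : ∀ h s a, ∀ j < G,
      |∑ s', P₀ h s a s' * cTransform (distPow p) (robustDP p ρ r Q h.succ) (θ * j) s' -
        ∑ s', Q h s a s' * cTransform (distPow p) (robustDP p ρ r Q h.succ) (θ * j) s'| ≤ t)
    {π : Policy S A H}
    (hπ : ∀ h s a, robustQ p ρ r Q h (robustDP p ρ r Q h.succ) s a ≤
      robustQ p ρ r Q h (robustDP p ρ r Q h.succ) s (π h s)) :
    ‖optRobustValue p ρ r P₀ - robustValue p ρ r P₀ π‖ ≤ 2 * H * (t + θ * maxDistPow S p) := by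
  have hη : 0 ≤ t + θ * maxDistPow S p := by
    have := maxDistPow_nonneg S p
    positivity
  refine norm_optRobustValue_sub_le hp hρ.le hη hP₀ (fun h s a => ?_) hπ
  exact abs_worstCase_sub_le_of_grid hp hρ (hP₀ h s a) (hQ h s a)
    (robustDP_mem_Icc hp hρ.le hr hQ h.succ) hθ (by rwa [sub_zero]) (hgrid h s a)

end DynamicProgramming

section Empirical

variable {S A : Type*} {H N : ℕ} [Fintype S]

theorem sum_empiricalModel_mul (D : Fin H → S → A → Fin N → S) (h : Fin H) (s : S) (a : A)
    (f : S → ℝ) : ∑ s', empiricalModel D h s a s' * f s' = (∑ i, f (D h s a i)) / N := by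
  classical
  simp_rw [empiricalModel, div_mul_eq_mul_div, ← Finset.sum_div, ← nsmul_eq_mul,
    ← Finset.sum_fiberwise Finset.univ (D h s a) fun i => f (D h s a i)]
  congr! 2 with s' _
  exact (Finset.sum_eq_card_nsmul fun i hi => by rw [(Finset.mem_filter.1 hi).2]).symm

theorem empiricalModel_mem_stdSimplex (hN : N ≠ 0) (D : Fin H → S → A → Fin N → S) (h : Fin H)
    (s : S) (a : A) : empiricalModel D h s a ∈ stdSimplex ℝ S := by
  refine ⟨fun s' => by rw [empiricalModel]; positivity, ?_⟩
  simpa [hN] using sum_empiricalModel_mul D h s a fun _ => 1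

end Empirical

section Concentration

open MeasureTheory ProbabilityTheory

variable {Ω : Type*} [MeasurableSpace Ω] {μ : Measure Ω} [IsProbabilityMeasure μ]

theorem measureReal_le_of_indepFun {α β : Type*} [MeasurableSpace α] [MeasurableSpace β]
    {Y : Ω → α} {Z : Ω → β} (hYZ : IndepFun Y Z μ) (hY : AEMeasurable Y μ)
    (hZ : AEMeasurable Z μ) {B : Set (α × β)} (hB : MeasurableSet B) {c : ℝ}
    (hc : ∀ y, μ.real {ω | (y, Z ω) ∈ B} ≤ c) : μ.real {ω | (Y ω, Z ω) ∈ B} ≤ c := by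
  obtain ⟨ω₀⟩ := nonempty_of_isProbabilityMeasure μ
  have hc₀ : 0 ≤ c := measureReal_nonneg.trans (hc (Y ω₀))
  refine ENNReal.toReal_le_of_le_ofReal hc₀ ?_
  calc μ ((fun ω => (Y ω, Z ω)) ⁻¹' B)
      = ∫⁻ y, μ.map Z (Prod.mk y ⁻¹' B) ∂μ.map Y := by
        rw [← Measure.map_apply_of_aemeasurable (hY.prodMk hZ) hB,
          hYZ.map_prod_eq_prod_map_map hY hZ, Measure.prod_apply hB]
    _ ≤ ∫⁻ _, ENNReal.ofReal c ∂μ.map Y := lintegral_mono fun y => by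
        rw [Measure.map_apply_of_aemeasurable hZ (measurable_prodMk_left hB)]
        exact (ENNReal.le_ofReal_iff_toReal_le (measure_ne_top μ _) hc₀).2 (hc y)
    _ = ENNReal.ofReal c := by
        have := Measure.isProbabilityMeasure_map hY
        rw [lintegral_const, measure_univ, mul_one]

section Hoeffding

variable {ι : Type*} [Fintype ι] [Nonempty ι] {Y : ι → Ω → ℝ} {a b m t : ℝ}

theorem measureReal_add_le_average (hY : ∀ i, AEMeasurable (Y i) μ) (hindep : iIndepFun Y μ)
    (hmem : ∀ i, ∀ᵐ ω ∂μ, Y i ω ∈ Set.Icc a b) (hmean : ∀ i, ∫ ω, Y i ω ∂μ = m) (ht : 0 ≤ t) :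
    μ.real {ω | m + t ≤ (∑ i, Y i ω) / Fintype.card ι} ≤
      Real.exp (-(2 * Fintype.card ι * t ^ 2 / (b - a) ^ 2)) := by
  have hn : (0 : ℝ) < Fintype.card ι := by exact_mod_cast Fintype.card_pos
  have hsub i : HasSubgaussianMGF (fun ω => Y i ω - m) ((‖b - a‖₊ / 2) ^ 2) μ := by
    rw [← hmean i]
    exact hasSubgaussianMGF_of_mem_Icc (hY i) (hmem i)
  have hcentered : iIndepFun (fun i ω => Y i ω - m) μ :=
    hindep.comp (fun _ x => x - m) fun _ => by fun_prop
  calc μ.real {ω | m + t ≤ (∑ i, Y i ω) / Fintype.card ι}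
      = μ.real {ω | Fintype.card ι * t ≤ ∑ i, (Y i ω - m)} := by
        congr! 3 with ω
        rw [le_div_iff₀ hn, Finset.sum_sub_distrib, Finset.sum_const, Finset.card_univ,
          nsmul_eq_mul, le_sub_iff_add_le']
        ring_nf
    _ ≤ _ := HasSubgaussianMGF.measure_sum_ge_le_of_iIndepFun hcentered (fun i _ => hsub i)
        (mul_nonneg hn.le ht)
    _ = Real.exp (-(2 * Fintype.card ι * t ^ 2 / (b - a) ^ 2)) := by
        congr 1
        simp only [Finset.sum_const, Finset.card_univ, nsmul_eq_mul, NNReal.coe_mul,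
          NNReal.coe_natCast, NNReal.coe_pow, NNReal.coe_div, coe_nnnorm, NNReal.coe_ofNat,
          Real.norm_eq_abs, div_pow, sq_abs]
        field_simp

theorem measureReal_le_abs_average_sub (hY : ∀ i, AEMeasurable (Y i) μ) (hindep : iIndepFun Y μ)
    (hmem : ∀ i, ∀ᵐ ω ∂μ, Y i ω ∈ Set.Icc a b) (hmean : ∀ i, ∫ ω, Y i ω ∂μ = m) (ht : 0 ≤ t) :
    μ.real {ω | t ≤ |(∑ i, Y i ω) / Fintype.card ι - m|} ≤
      2 * Real.exp (-(2 * Fintype.card ι * t ^ 2 / (b - a) ^ 2)) := by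
  have hupper := measureReal_add_le_average hY hindep hmem hmean ht
  have hlower := measureReal_add_le_average (Y := fun i ω => -Y i ω) (a := -b) (b := -a) (m := -m)
    (fun i => (hY i).neg) (hindep.comp (fun _ x => -x) fun _ => measurable_neg)
    (fun i => by filter_upwards [hmem i] with ω hω using ⟨neg_le_neg hω.2, neg_le_neg hω.1⟩)
    (fun i => by rw [integral_neg, hmean i]) ht
  rw [neg_sub_neg] at hlower
  rw [two_mul]
  refine (measureReal_mono fun ω hω => ?_).trans
    ((measureReal_union_le _ _).trans (add_le_add hupper hlower))
  simp only [Set.mem_union, Set.mem_ofPred_eq, Finset.sum_neg_distrib, neg_div] at hω ⊢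
  exact (le_abs'.1 hω).symm.imp (fun h => by linarith) fun h => by linarith

end Hoeffding

variable {S : Type*} [Fintype S] [MeasurableSpace S] [MeasurableSingletonClass S]

theorem integral_comp_eq_sum_mul {X : Ω → S} (hX : AEMeasurable X μ) {P : S → ℝ}
    (hlaw : ∀ s, μ.real {ω | X ω = s} = P s) (f : S → ℝ) :
    ∫ ω, f (X ω) ∂μ = ∑ s, P s * f s := by
  rw [← integral_map hX (measurable_of_finite f).aestronglyMeasurable,
    integral_fintype .of_finite]
  refine Finset.sum_congr rfl fun s _ => ?_
  rw [map_measureReal_apply_of_aemeasurable hX (measurableSet_singleton s), smul_eq_mul, ← hlaw s]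
  rfl

theorem measureReal_le_abs_average_sub_of_indepFun {ι : Type*} [Fintype ι] [Nonempty ι]
    {X : ι → Ω → S} (hX : ∀ i, Measurable (X i)) (hindep : iIndepFun X μ) {P : S → ℝ}
    (hlaw : ∀ i s, μ.real {ω | X i ω = s} = P s) {W : Ω → S → ℝ} (hW : Measurable W) {a b : ℝ}
    (hmem : ∀ ω s, W ω s ∈ Set.Icc a b) (hWX : IndepFun W (fun ω i => X i ω) μ) {t : ℝ}
    (ht : 0 ≤ t) :
    μ.real {ω | t ≤ |(∑ i, W ω (X i ω)) / Fintype.card ι - ∑ s, P s * W ω s|} ≤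
      2 * Real.exp (-(2 * Fintype.card ι * t ^ 2 / (b - a) ^ 2)) := by
  let B : Set ((S → ℝ) × (ι → S)) := {z | (∀ s, z.1 s ∈ Set.Icc a b) ∧
    t ≤ |(∑ i, z.1 (z.2 i)) / Fintype.card ι - ∑ s, P s * z.1 s|}
  have hdev : Measurable fun z : (S → ℝ) × (ι → S) =>
      |(∑ i, z.1 (z.2 i)) / Fintype.card ι - ∑ s, P s * z.1 s| :=
    measurable_from_prod_countable_left fun x => by fun_prop
  have hB : MeasurableSet B :=
    (measurable_fst (MeasurableSet.univ_pi' fun _ => measurableSet_Icc)).inter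
      (measurableSet_le measurable_const hdev)
  have hfixed (w : S → ℝ) : μ.real {ω | (w, fun i => X i ω) ∈ B} ≤
      2 * Real.exp (-(2 * Fintype.card ι * t ^ 2 / (b - a) ^ 2)) := by
    by_cases hw : ∀ s, w s ∈ Set.Icc a b
    · have := measureReal_le_abs_average_sub (Y := fun i ω => w (X i ω))
        (fun i => ((measurable_of_finite w).comp (hX i)).aemeasurable)
        (hindep.comp (fun _ => w) fun _ => measurable_of_finite w)
        (fun i => .of_forall fun ω => hw (X i ω))
        (fun i => integral_comp_eq_sum_mul (hX i).aemeasurable (hlaw i) w) ht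
      exact (measureReal_mono fun ω hω => hω.2).trans this
    · simp only [B, Set.mem_ofPred_eq, hw, false_and, Set.ofPred_false, measureReal_empty]
      positivity
  have hjoint := measureReal_le_of_indepFun hWX hW.aemeasurable
    (measurable_pi_iff.2 hX).aemeasurable hB hfixed
  exact (measureReal_mono fun ω hω => And.intro (hmem ω) hω).trans hjoint

theorem one_sub_le_measureReal_of_compl_subset {A B : Set Ω} (hAB : Aᶜ ⊆ B) {c : ℝ}
    (hB : μ.real B ≤ c) : 1 - c ≤ μ.real A := by
  have hcover : μ.real Set.univ ≤ μ.real (A ∪ B) :=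
    measureReal_mono fun ω _ => or_iff_not_imp_left.2 fun hω => hAB hω
  rw [probReal_univ] at hcover
  linarith [measureReal_union_le (μ := μ) A B]

end Concentration

section RobustPhasedValueLearning

open MeasureTheory ProbabilityTheory

variable {S A Ω : Type*} {H N : ℕ} [Fintype S] [MetricSpace S] [MeasurableSpace S]
  [MeasurableSingletonClass S] [MeasurableSpace Ω] {μ : Measure Ω} {p ρ : ℝ}
  {X : Fin H → S → A → Fin N → Ω → S}

theorem measurable_robustDP_empiricalModel [Finite A] (p ρ : ℝ) (r : Fin H → S → A → ℝ)
    (hX : ∀ h s a i, Measurable (X h s a i)) (k : Fin (H + 1)) :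
    Measurable fun ω => robustDP p ρ r (empiricalModel fun h s a i => X h s a i ω) k :=
  (measurable_of_finite fun D : Fin H → S → A → Fin N → S =>
    robustDP p ρ r (empiricalModel D) k).comp (by fun_prop)

theorem indepFun_robustDP_succ [Finite A] [Nonempty S] (p ρ : ℝ) (r : Fin H → S → A → ℝ)
    (hX : ∀ h s a i, Measurable (X h s a i))
    (hindep : iIndepFun (fun k : Fin H × S × A × Fin N => X k.1 k.2.1 k.2.2.1 k.2.2.2) μ)
    (h : Fin H) (s : S) (a : A) :
    IndepFun (fun ω => robustDP p ρ r (empiricalModel fun h s a i => X h s a i ω) h.succ)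
      (fun ω i => X h s a i ω) μ := by
  classical
  have := Fintype.ofFinite A
  let later : Finset (Fin H × S × A × Fin N) := {k | h < k.1}
  let now : Finset (Fin H × S × A × Fin N) := {k | k.1 = h}
  have hdisj : Disjoint later now := Finset.disjoint_filter.2 fun k _ hlt heq => hlt.ne' heq
  have hblocks := hindep.indepFun_finset later now hdisj fun k => hX k.1 k.2.1 k.2.2.1 k.2.2.2
  -- The backward induction after step `h` ignores the samples filled in here.
  let extend (y : later → S) : Fin H → S → A → Fin N → S := fun h' s a i =>
    if hk : (h', s, a, i) ∈ later then y ⟨(h', s, a, i), hk⟩ else Classical.arbitrary S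
  have hextend (ω : Ω) : robustDP p ρ r (empiricalModel fun h s a i => X h s a i ω) h.succ =
      robustDP p ρ r (empiricalModel (extend fun k => X k.1.1 k.1.2.1 k.1.2.2.1 k.1.2.2.2 ω))
        h.succ := by
    refine robustDP_congr p ρ r fun j hj => ?_
    funext s a s'
    simp [empiricalModel, extend, later, Fin.succ_le_castSucc_iff.1 hj]
  simp_rw [hextend]
  exact hblocks.comp (measurable_of_finite fun y => robustDP p ρ r (empiricalModel (extend y)) _)
    (measurable_of_finite fun z i => z ⟨(h, s, a, i), by simp [now]⟩)

variable [IsProbabilityMeasure μ] [Nonempty S] [Nonempty A]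

theorem measureReal_le_abs_sum_mul_cTransform_sub [Finite A] (hp : 0 < p) (hρ : 0 ≤ ρ)
    {r : Fin H → S → A → ℝ} (hr : ∀ h s a, r h s a ∈ Set.Icc (0 : ℝ) 1) {P₀ : Model S A H}
    (hX : ∀ h s a i, Measurable (X h s a i))
    (hlaw : ∀ h s a i s', μ.real {ω | X h s a i ω = s'} = P₀ h s a s')
    (hindep : iIndepFun (fun k : Fin H × S × A × Fin N => X k.1 k.2.1 k.2.2.1 k.2.2.2) μ)
    (hN : N ≠ 0) (h : Fin H) (s : S) (a : A) {l t : ℝ} (hl : 0 ≤ l) (ht : 0 ≤ t) :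
    μ.real {ω | t ≤ |∑ s', P₀ h s a s' * cTransform (distPow p)
          (robustDP p ρ r (empiricalModel fun h s a i => X h s a i ω) h.succ) l s' -
        ∑ s', empiricalModel (fun h s a i => X h s a i ω) h s a s' * cTransform (distPow p)
          (robustDP p ρ r (empiricalModel fun h s a i => X h s a i ω) h.succ) l s'|} ≤
      2 * Real.exp (-(2 * N * t ^ 2 / H ^ 2)) := by
  have : Nonempty (Fin N) := ⟨⟨0, Nat.pos_of_ne_zero hN⟩⟩
  have hsample : iIndepFun (X h s a) μ :=
    hindep.precomp (g := fun i => (h, s, a, i)) fun i j hij => by simpa using hij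
  have hmem (ω : Ω) (y : S) : cTransform (distPow p)
      (robustDP p ρ r (empiricalModel fun h s a i => X h s a i ω) h.succ) l y ∈
        Set.Icc (0 : ℝ) H :=
    cTransform_mem_Icc (fun x => distPow_nonneg p x y) ⟨y, distPow_self hp y⟩
      (robustDP_mem_Icc hp hρ hr (empiricalModel_mem_stdSimplex hN _) h.succ) hl
  have hdev := measureReal_le_abs_average_sub_of_indepFun (hX h s a) hsample (hlaw h s a)
    ((measurable_cTransform (distPow p) l).comp
      (measurable_robustDP_empiricalModel p ρ r hX h.succ)) hmem
    ((indepFun_robustDP_succ p ρ r hX hindep h s a).comp (measurable_cTransform (distPow p) l)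
      measurable_id) ht
  simpa only [Function.comp_apply, Fintype.card_fin, sub_zero, abs_sub_comm,
    sum_empiricalModel_mul] using hdev

theorem one_sub_le_measureReal_isOutput [Fintype A] (hp : 0 < p) (hρ : 0 < ρ)
    {r : Fin H → S → A → ℝ} (hr : ∀ h s a, r h s a ∈ Set.Icc (0 : ℝ) 1) {P₀ : Model S A H}
    (hP₀ : ∀ h s a, P₀ h s a ∈ stdSimplex ℝ S) (hX : ∀ h s a i, Measurable (X h s a i))
    (hlaw : ∀ h s a i s', μ.real {ω | X h s a i ω = s'} = P₀ h s a s')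
    (hindep : iIndepFun (fun k : Fin H × S × A × Fin N => X k.1 k.2.1 k.2.2.1 k.2.2.2) μ)
    (hN : N ≠ 0) {θ t : ℝ} (hθ : 0 < θ) (ht : 0 ≤ t) {G : ℕ} (hG : H / ρ ^ p < θ * G) :
    1 - H * Fintype.card S * Fintype.card A * G * (2 * Real.exp (-(2 * N * t ^ 2 / H ^ 2))) ≤
      μ.real {ω | ∀ πhat, IsOutput p ρ r (fun h s a i => X h s a i ω) πhat →
        ‖optRobustValue p ρ r P₀ - robustValue p ρ r P₀ πhat‖ ≤
          2 * H * (t + θ * maxDistPow S p)} := by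
  let bad (k : Fin H × S × A × Fin G) : Set Ω :=
    {ω | t ≤ |∑ s', P₀ k.1 k.2.1 k.2.2.1 s' * cTransform (distPow p)
          (robustDP p ρ r (empiricalModel fun h s a i => X h s a i ω) k.1.succ) (θ * k.2.2.2) s' -
        ∑ s', empiricalModel (fun h s a i => X h s a i ω) k.1 k.2.1 k.2.2.1 s' *
          cTransform (distPow p)
            (robustDP p ρ r (empiricalModel fun h s a i => X h s a i ω) k.1.succ)
            (θ * k.2.2.2) s'|}
  have hunion : μ.real (⋃ k, bad k) ≤ H * Fintype.card S * Fintype.card A * G *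
      (2 * Real.exp (-(2 * N * t ^ 2 / H ^ 2))) :=
    calc μ.real (⋃ k, bad k) ≤ ∑ k, μ.real (bad k) := measureReal_iUnion_fintype_le _
      _ ≤ ∑ _k : Fin H × S × A × Fin G, 2 * Real.exp (-(2 * N * t ^ 2 / H ^ 2)) :=
        Finset.sum_le_sum fun k _ => measureReal_le_abs_sum_mul_cTransform_sub hp hρ.le hr hX hlaw
          hindep hN k.1 k.2.1 k.2.2.1 (by positivity) ht
      _ = _ := by simp [Finset.card_univ, mul_assoc]
  refine one_sub_le_measureReal_of_compl_subset (Set.compl_subset_comm.1 fun ω hω πhat hπ => ?_)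
    hunion
  refine norm_optRobustValue_sub_le_of_grid hp hρ hr hP₀ (empiricalModel_mem_stdSimplex hN _) hθ
    ht hG (fun h s a j hj => ?_) hπ
  by_contra! hdev
  exact hω (Set.mem_iUnion.2 ⟨(h, s, a, ⟨j, hj⟩), hdev.le⟩)

end RobustPhasedValueLearning

section RealParameters

variable {H N nS nA B R δ ε : ℝ}

theorem mul_exp_neg_le_of_log_div_le {M x : ℝ} (hM : 0 < M) (hδ : 0 < δ)
    (hx : Real.log (M / δ) ≤ x) : M * Real.exp (-x) ≤ δ := by
  rw [Real.exp_neg, ← div_eq_mul_inv, div_le_iff₀ (Real.exp_pos x), ← div_le_iff₀' hδ]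
  exact (Real.log_le_iff_le_exp (div_pos hM hδ)).1 hx

theorem floor_add_one_le (hH : 0 < H) (hB : 0 ≤ B) (hR : 0 < R) (hε : ε ∈ Set.Ioo 0 H) :
    ((⌊H / R / (ε / (4 * H * B + H))⌋₊ + 1 : ℕ) : ℝ) ≤
      4 * H * (H * B + max H R) / (R * ε) := by
  have hε₀ := hε.1
  have hfloor := Nat.floor_le (show 0 ≤ H / R / (ε / (4 * H * B + H)) by positivity)
  have hRε : R * ε ≤ max H R * H :=
    mul_le_mul (le_max_right H R) hε.2.le hε₀.le (hR.le.trans (le_max_right H R))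
  have hHH : H * H ≤ max H R * H := by gcongr; exact le_max_left H R
  push_cast
  calc (⌊H / R / (ε / (4 * H * B + H))⌋₊ : ℝ) + 1
      ≤ H / R / (ε / (4 * H * B + H)) + 1 := by gcongr
    _ = (4 * H * (H * B) + H * H + R * ε) / (R * ε) := by field_simp
    _ ≤ 4 * H * (H * B + max H R) / (R * ε) := by
        gcongr
        linarith [mul_nonneg (hR.le.trans (le_max_right H R)) hH.le]

theorem union_bound_le {K G : ℝ} (hH : 0 < H) (hnS : 0 < nS) (hnA : 0 < nA) (hK : 0 < K)
    (hR : 0 < R) (hδ : 0 < δ) (hε : 0 < ε) (hG : G ≤ 4 * H * K / (R * ε))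
    (hN : 8 * H ^ 4 / ε ^ 2 * Real.log (8 * H ^ 2 * nS * nA * K / (R * δ * ε)) ≤ N) :
    H * nS * nA * G * (2 * Real.exp (-(2 * N * (ε / (4 * H)) ^ 2 / H ^ 2))) ≤ δ := by
  calc H * nS * nA * G * (2 * Real.exp (-(2 * N * (ε / (4 * H)) ^ 2 / H ^ 2)))
      ≤ H * nS * nA * (4 * H * K / (R * ε)) *
          (2 * Real.exp (-(2 * N * (ε / (4 * H)) ^ 2 / H ^ 2))) := by gcongr
    _ = 8 * H ^ 2 * nS * nA * K / (R * ε) * Real.exp (-(N / (8 * H ^ 4 / ε ^ 2))) := by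
        rw [show 2 * N * (ε / (4 * H)) ^ 2 / H ^ 2 = N / (8 * H ^ 4 / ε ^ 2) by field_simp; ring]
        ring
    _ ≤ δ := by
        refine mul_exp_neg_le_of_log_div_le (by positivity) hδ ?_
        rwa [le_div_iff₀' (by positivity), div_div, mul_right_comm R]

theorem two_mul_mul_add_mul_le (hH : 0 < H) (hB : 0 ≤ B) (hε : 0 ≤ ε) :
    2 * H * (ε / (4 * H) + ε / (4 * H * B + H) * B) ≤ ε := by
  have hmesh : ε / (4 * H * B + H) * B ≤ ε / (4 * H) := by
    rw [div_mul_eq_mul_div, div_le_div_iff₀ (by positivity) (by positivity)]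
    linarith [mul_nonneg hε hH.le]
  calc 2 * H * (ε / (4 * H) + ε / (4 * H * B + H) * B)
      ≤ 2 * H * (ε / (4 * H) + ε / (4 * H)) := by gcongr
    _ = ε := by field_simp; ring

end RealParameters

section CountParameters

variable {H nS nA : ℕ} {B δ ε : ℝ}

theorem log_ratio_pos {R : ℝ} (hnS : 0 < nS) (hnA : 0 < nA) (hB : 0 ≤ B) (hR : 0 < R)
    (hδ : δ ∈ Set.Ioo (0 : ℝ) 1) (hε : ε ∈ Set.Ioo (0 : ℝ) H) :
    0 < Real.log (8 * H ^ 2 * nS * nA * (H * B + max (H : ℝ) R) / (R * δ * ε)) := by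
  obtain ⟨hδ₀, hδ₁⟩ := hδ
  obtain ⟨hε₀, hεH⟩ := hε
  have hH : (1 : ℝ) ≤ H := by exact_mod_cast hε₀.trans hεH
  have hnS' : (1 : ℝ) ≤ nS := by exact_mod_cast hnS
  have hnA' : (1 : ℝ) ≤ nA := by exact_mod_cast hnA
  have hRmax : R ≤ H * B + max (H : ℝ) R :=
    (le_max_right _ R).trans (le_add_of_nonneg_left (by positivity))
  refine Real.log_pos ((one_lt_div (by positivity)).2 ?_)
  calc R * δ * ε < R * 1 * H := by gcongr
    _ = 1 * H * 1 * 1 * R := by ring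
    _ ≤ 8 * H ^ 2 * nS * nA * (H * B + max (H : ℝ) R) := by
        gcongr
        exacts [by norm_num, le_self_pow₀ hH two_ne_zero]

theorem le_of_sampleBound_le {p ρ N : ℝ} (hnS : 0 < nS) (hnA : 0 < nA) (hB : 0 ≤ B) (hρ : 0 < ρ)
    (hδ : δ ∈ Set.Ioo (0 : ℝ) 1) (hε : ε ∈ Set.Ioo (0 : ℝ) H)
    (hN : sampleBound H nS nA B p ρ δ ε ≤ N * nS * nA * H) :
    8 * H ^ 4 / ε ^ 2 * Real.log (8 * H ^ 2 * nS * nA * (H * B + max (H : ℝ) (ρ ^ p)) /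
      (ρ ^ p * δ * ε)) ≤ N := by
  have hR : 0 < ρ ^ p := Real.rpow_pos_of_pos hρ p
  have hlog := log_ratio_pos hnS hnA hB hR hδ hε
  have hH : (0 : ℝ) < H := hε.1.trans hε.2
  have hε₀ := hε.1
  have hδ₀ := hδ.1
  have hfactor : 1 ≤ (B + ρ ^ p) ^ 2 / (ρ ^ p) ^ 2 := by
    rw [one_le_div (by positivity)]
    gcongr
    exact le_add_of_nonneg_left hB
  refine le_of_mul_le_mul_right (le_trans ?_ (hN.trans_eq ?_))
    (show (0 : ℝ) < nS * nA * H by positivity)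
  · rw [sampleBound, mul_comm 2 p, Real.rpow_mul hρ.le, Real.rpow_two]
    calc _ = 8 * H ^ 4 / ε ^ 2 * (nS * nA * H) * (1 * Real.log (8 * H ^ 2 * nS * nA *
            (H * B + max (H : ℝ) (ρ ^ p)) / (ρ ^ p * δ * ε))) := by ring
      _ ≤ 8 * H ^ 4 / ε ^ 2 * (nS * nA * H) * ((B + ρ ^ p) ^ 2 / (ρ ^ p) ^ 2 *
            Real.log (16 * H ^ 2 * nS * nA * (H * B + max (H : ℝ) (ρ ^ p)) /
              (ρ ^ p * δ * ε))) := by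
          gcongr
          norm_num
      _ = _ := by ring
  · ring

end CountParameters

end RPVL

end

theorem theorem5_general {S A Ω : Type*} [Fintype S] [Nonempty S] [MetricSpace S]
    [MeasurableSpace S] [MeasurableSingletonClass S] [Fintype A] [Nonempty A]
    (H N : ℕ) (p ρ δ ε : ℝ) (hp : 0 < p) (hρ : 0 < ρ)
    (hδ : δ ∈ Set.Ioo (0 : ℝ) 1) (hε : ε ∈ Set.Ioo (0 : ℝ) (H : ℝ))
    (r : Fin H → S → A → ℝ) (hr : ∀ h s a, r h s a ∈ Set.Icc (0 : ℝ) 1)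
    (P₀ : RPVL.Model S A H) (hP₀ : ∀ h s a, P₀ h s a ∈ stdSimplex ℝ S)
    [MeasurableSpace Ω] (μ : MeasureTheory.Measure Ω) [MeasureTheory.IsProbabilityMeasure μ]
    (X : Fin H → S → A → Fin N → Ω → S)
    (hX : ∀ h s a i, Measurable (X h s a i))
    (hlaw : ∀ h s a i s', μ.real {ω | X h s a i ω = s'} = P₀ h s a s')
    (hindep : ProbabilityTheory.iIndepFun
      (fun k : Fin H × S × A × Fin N => X k.1 k.2.1 k.2.2.1 k.2.2.2) μ)
    (hN : 8 * (H : ℝ) ^ 4 / ε ^ 2 * Real.log (8 * H ^ 2 * Fintype.card S * Fintype.card A *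
      (H * RPVL.maxDistPow S p + max (H : ℝ) (ρ ^ p)) / (ρ ^ p * δ * ε)) ≤ N) :
    1 - δ ≤ μ.real {ω | ∀ πhat : RPVL.Policy S A H,
      RPVL.IsOutput p ρ r (fun h s a i => X h s a i ω) πhat →
        ‖RPVL.optRobustValue p ρ r P₀ - RPVL.robustValue p ρ r P₀ πhat‖ ≤ ε} := by
  obtain ⟨hε₀, hεH⟩ := hε
  have hH : 0 < (H : ℝ) := hε₀.trans hεH
  have hR : 0 < ρ ^ p := Real.rpow_pos_of_pos hρ p
  have hB := RPVL.maxDistPow_nonneg S p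
  have hN₀ : N ≠ 0 := by
    have hlog := RPVL.log_ratio_pos (H := H) (Fintype.card_pos (α := S))
      (Fintype.card_pos (α := A)) hB hR hδ ⟨hε₀, hεH⟩
    exact_mod_cast ((show (0 : ℝ) < _ by positivity).trans_le hN).ne'
  set B := RPVL.maxDistPow S p
  -- Each step may err by `ε / (2 * H)`: half of it is left to sampling, half to the mesh `θ` of the
  -- grid of multipliers.
  set θ : ℝ := ε / (4 * H * B + H)
  have hθ₀ : 0 < θ := by positivity
  have hgrid : H / ρ ^ p < θ * ↑(⌊H / ρ ^ p / θ⌋₊ + 1) := by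
    rw [← div_lt_iff₀' hθ₀]
    exact_mod_cast Nat.lt_floor_add_one (H / ρ ^ p / θ)
  have hfail := RPVL.union_bound_le hH (Nat.cast_pos.2 Fintype.card_pos)
    (Nat.cast_pos.2 Fintype.card_pos) (by positivity) hR hδ.1 hε₀
    (RPVL.floor_add_one_le hH hB hR ⟨hε₀, hεH⟩) hN
  refine (sub_le_sub_left hfail 1).trans <| (RPVL.one_sub_le_measureReal_isOutput hp hρ hr hP₀ hX
    hlaw hindep hN₀ hθ₀ (by positivity) hgrid).trans <| MeasureTheory.measureReal_mono ?_
  exact fun ω hω πhat hπ => (hω πhat hπ).trans (RPVL.two_mul_mul_add_mul_le hH hB hε₀.le)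

theorem theorem5 {S A Ω : Type*} [Fintype S] [Nonempty S] [MetricSpace S]
    [MeasurableSpace S] [MeasurableSingletonClass S] [Fintype A] [Nonempty A]
    (H N : ℕ) (p ρ δ ε : ℝ) (hp : 1 ≤ p) (hρ : 0 < ρ)
    (hδ : δ ∈ Set.Ioo (0 : ℝ) 1) (hε : ε ∈ Set.Ioo (0 : ℝ) (H : ℝ))
    (r : Fin H → S → A → ℝ) (hr : ∀ h s a, r h s a ∈ Set.Icc (0 : ℝ) 1)
    (P₀ : RPVL.Model S A H) (hP₀ : ∀ h s a, P₀ h s a ∈ stdSimplex ℝ S)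
    [MeasurableSpace Ω] (μ : MeasureTheory.Measure Ω) [MeasureTheory.IsProbabilityMeasure μ]
    (X : Fin H → S → A → Fin N → Ω → S)
    (hX : ∀ h s a i, Measurable (X h s a i))
    (hlaw : ∀ h s a i s', μ.real {ω | X h s a i ω = s'} = P₀ h s a s')
    (hindep : ProbabilityTheory.iIndepFun
      (fun k : Fin H × S × A × Fin N => X k.1 k.2.1 k.2.2.1 k.2.2.2) μ)
    (hN : RPVL.sampleBound H (Fintype.card S) (Fintype.card A) (RPVL.maxDistPow S p) p ρ δ ε ≤
      (N : ℝ) * Fintype.card S * Fintype.card A * H) :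
    1 - δ ≤ μ.real {ω | ∀ πhat : RPVL.Policy S A H,
      RPVL.IsOutput p ρ r (fun h s a i => X h s a i ω) πhat →
        ‖RPVL.optRobustValue p ρ r P₀ - RPVL.robustValue p ρ r P₀ πhat‖ ≤ ε} :=
  theorem5_general H N p ρ δ ε (by linarith) hρ hδ hε r hr P₀ hP₀ μ X hX hlaw hindep <|
    RPVL.le_of_sampleBound_le Fintype.card_pos Fintype.card_pos (RPVL.maxDistPow_nonneg S p) hρ hδ
      hε hN
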